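/- **Setting.** For $q\in L^2([0,1])$ put $\eta(q)(x)=\exp\int_0^x q$ and $\varphi(q)(x)=\int_0^x\eta(q)$. Let $Q=\{q\in L^2([0,1]) : \int_0^1 q=0,\ \int_0^1\eta(q)=1\}$, with tangent space $T_qQ=\{X\in L^2 : \int_0^1 X=\int_0^1 X\varphi(q)=0\}$ and metric $G(q)(X,X)=\int_0^1 X^2/\eta(q)$; via $q=\partial_x\log\partial_x\varphi$ this is the group $\mathrm{Diff}_0^2([0,1])$ with its right-invariant $H^2_0$ metric. Identify $T_q^*Q$ with $\{p\in L^2:\eta(q)p\in T_qQ\}$, with norm $\|p\|_q^2=\int_0^1\eta(q)p^2$, and let $$\pi_q^*(f)=f-\begin{bmatrix}1&\varphi\end{bmatrix}H_2^{-1}\begin{bmatrix}\int_0^1\eta f\\ \int_0^1\eta\varphi f\end{bmatrix},\qquad H_2=\begin{bmatrix}1&1/2\\1/2&1/3\end{bmatrix}.$$ Put $\mathcal U(m,q)(x)=\frac12\int_x^1\eta(q)\,dm$ for a function or a measure $m$ on $[0,1]$, $\pi_1(p,q)=\begin{bmatrix}1&\varphi\end{bmatrix}H_2^{-1}\begin{bmatrix}0\\b\end{bmatrix}$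 with $b=\frac32\int_0^1\eta(x)\big(\int_0^x\eta p\,dy\big)^2dx$, and $\pi_2(q,f)=(\mathrm{id}-\pi_q^*)(\mathcal U(f,q))$. Given $(p_0,q_0)$, let $\mathcal C^0$ be the set of curves $(p(t),q(t))_{t\in[0,1]}$ with $q(t)\in Q$, $p(t)\in T^*_{q(t)}Q$, $q\in H^2([0,1],L^2([0,1]))$, $\dot q=\eta(q)p$, $q(0)=q_0$, $p(0)=p_0$; given also $(p_1,q_1)$, let $\mathcal C^{0,1}$ be the subset of those with $q(1)=q_1$, $p(1)=p_1$. Let $\mathcal C$ denote either of these sets. The covariant acceleration of such a curve is, as a covector, $\big(\frac D{Dt}\dot q\big)^\flat=\dot p+\mathcal U(p^2,q)-\pi_1(p,q)-\pi_2(q,p^2)$; the curve is a geodesic if it solves $\dot q=\eta(q)p$, $\dot p=-\mathcal U(p^2,q)+\pi_1(p,q)+\pi_2(q,p^2)$ on $[0,1]$. Let $D=[0,1]^2$ with variables $(t,x)$. For a finite positive measure $\mu$ and a finite signed measure $\nu$ on $D$ and a positive continuous $f$, put $\mathrm{FR}_f(\mu,\nu)=\int_D r\big(\frac{d\mu}{d\lambda},\frac{d\nu}{d\lambda}\big)f\,d\lambda$,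 where $\lambda$ is any measure dominating $\mu$ and $|\nu|$, and $r(x,y)=\frac{y^2}{4x}$ if $x>0$, $r(0,0)=0$, $r=+\infty$ otherwise. Let $\mathcal M_0(D)$ be the set of finite positive measures $\Delta$ on $D$ with $\Delta_{t=0}=0$, where the conditions $\Delta_{t=0}=0$ and $\partial_t\Delta=\delta\in\mathcal M(D)$ (signed) are understood weakly: $\langle\partial_tf,\Delta\rangle+\langle f,\delta\rangle=0$ for all $f\in C^0(D)$ that are $C^1$ in $t$ and satisfy $f(1,\cdot)=0$. For a functional $P$ of $(p(1),q(1))$ with real values, let $$\mathcal F(\Delta,p,q)=\mathrm{FR}_{\eta(q)}(\Delta,\partial_t\Delta)+\int_0^1\Big\|\Big(\frac D{Dt}\dot q\Big)^\flat+\pi_q^*(\mathcal U(\Delta_t,q))\Big\|_q^2dt+P(p(1),q(1)),$$ where $\Delta=\Delta_t\,dt$, and $\mathcal F=+\infty$ if $\partial_t\Delta$ is not a measure. **Statement.** For every geodesic $(p,q)\in\mathcal C$, the curve $q$ belongs to $C^2([0,1],L^2([0,1]))$, and there is an open neighborhood $U$ of $q$ in $C^2([0,1],L^2([0,1]))$ such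 that for every $(\tilde p,\tilde q)\in\mathcal C$ with $\tilde q\in U$ the functional $\Delta\mapsto\mathcal F(\Delta,\tilde p,\tilde q)$ attains its minimum over $\mathcal M_0(D)$ at $\Delta=0$. That is, the set of paths $(p,q)\in\mathcal C$ such that $\mathcal F$ has an optimum with respect to $\Delta$ at $\Delta=0$ contains an open neighborhood of every geodesic in the $C^2([0,1],L^2([0,1]))$ topology. -/

import Mathlib

open MeasureTheory Set
open scoped ENNReal

namespace DiffSpline

noncomputable section

/-! ### The Hilbert manifold `Q`, its cotangent bundle and its metric -/

/-- The Hilbert space `L²([0,1])` of functions of the space variable. -/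
abbrev L2 : Type := Lp ℝ 2 (volume.restrict (Icc (0 : ℝ) 1))

/-- The Jacobian `η(q)(x) = exp (∫₀ˣ q)`. -/
def eta (q : L2) (x : ℝ) : ℝ := Real.exp (∫ y in (0 : ℝ)..x, q y)

/-- The diffeomorphism `φ(q)(x) = ∫₀ˣ η(q)`. -/
def phi (q : L2) (x : ℝ) : ℝ := ∫ y in (0 : ℝ)..x, eta q y

/-- The submanifold `Q` of `L²([0,1])`, which represents `Diff₀²([0,1])` through
`q = ∂ₓ log ∂ₓφ`. -/
def Q : Set L2 :=
  {q | (∫ x in (0 : ℝ)..1, q x) = 0 ∧ (∫ x in (0 : ℝ)..1, eta q x) = 1}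

/-- The cotangent space `T_q^*Q`: the `p` such that `X = η(q) p` lies in the tangent space
`T_qQ = {X | ∫ X = 0, ∫ X φ(q) = 0}`.  (The metric on `T_qQ` is `G(q)(X,X) = ∫ X² / η(q)`, so
`X = η(q) p` is the vector with dual `p`, and the dual norm is `‖p‖_q² = ∫ η(q) p²`.) -/
def cotangent (q : L2) : Set L2 :=
  {p | (∫ x in (0 : ℝ)..1, eta q x * p x) = 0 ∧
       (∫ x in (0 : ℝ)..1, eta q x * p x * phi q x) = 0}

/-- The Gram matrix of `1, φ` for `⟨f, g⟩_η = ∫ η f g`. -/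
def H2 : Matrix (Fin 2) (Fin 2) ℝ := !![1, 1 / 2; 1 / 2, 1 / 3]

/-- The function `[1 φ] H₂⁻¹ [α; β]`. -/
def lift (q : L2) (α β : ℝ) (x : ℝ) : ℝ :=
  ![1, phi q x] ⬝ᵥ (H2⁻¹.mulVec ![α, β])

/-- The orthogonal projection `π_q^*` onto `T_q^*Q`. -/
def projStar (q : L2) (f : ℝ → ℝ) (x : ℝ) : ℝ :=
  f x - lift q (∫ y in (0 : ℝ)..1, eta q y * f y) (∫ y in (0 : ℝ)..1, eta q y * f y * phi q y) x

/-- The nonlocal operator `𝒰(m, q)(x) = ½ ∫_{[x,1]} η(q) dm` on measures in the space variable. -/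
def nonlocalMeas (m : Measure ℝ) (q : L2) (x : ℝ) : ℝ :=
  (1 / 2) * ∫ y in Icc x 1, eta q y ∂m

/-- The nonlocal operator `𝒰(f, q)(x) = ½ ∫ₓ¹ η(q) f` on functions. -/
def nonlocal (f : ℝ → ℝ) (q : L2) (x : ℝ) : ℝ :=
  (1 / 2) * ∫ y in x..1, eta q y * f y

/-- `b = (3/2) ∫₀¹ (∫₀ˣ p ∘ φ⁻¹)² dx`, written after the change of variable `φ`. -/
def coefB (p q : L2) : ℝ :=
  (3 / 2) * ∫ x in (0 : ℝ)..1, eta q x * (∫ y in (0 : ℝ)..x, eta q y * p y) ^ 2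

/-- `π₁(p, q) = [1 φ] H₂⁻¹ [0; b]`. -/
def proj1 (p q : L2) (x : ℝ) : ℝ := lift q 0 (coefB p q) x

/-- `π₂(q, f) = (id - π_q^*) (𝒰(f, q))`. -/
def proj2 (q : L2) (f : ℝ → ℝ) (x : ℝ) : ℝ :=
  nonlocal f q x - projStar q (nonlocal f q) x

/-! ### Paths in `T^*Q` -/

/-- A time-dependent pair `(p, q)`; only the times in `[0,1]` matter. -/
structure Path where
  p : ℝ → L2
  q : ℝ → L2

/-- `q ∈ H²([0,1], L²([0,1]))`: `q` has an `L²` second derivative `a`. -/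
def MemH2 (q : ℝ → L2) : Prop :=
  ∃ v a : ℝ → L2, MemLp a 2 (volume.restrict (Icc (0 : ℝ) 1)) ∧
    ∀ t ∈ Icc (0 : ℝ) 1,
      v t = v 0 + ∫ s in (0 : ℝ)..t, a s ∧ q t = q 0 + ∫ s in (0 : ℝ)..t, v s

/-- The first Hamilton equation `q̇ = η(q) p` on `[0,1]`. -/
def FirstEquation (γ : Path) : Prop :=
  ∀ t ∈ Icc (0 : ℝ) 1, ∃ v : L2, HasDerivWithinAt γ.q v (Icc 0 1) t ∧
    v =ᵐ[volume.restrict (Icc (0 : ℝ) 1)] fun x => eta (γ.q t) x * γ.p t x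

/-- The curves `(p, q)` in `T^*Q` with `q ∈ H²([0,1], L²)`, `q̇ = η(q) p`, `q(0) = q₀`,
`p(0) = p₀`. -/
def curves0 (p₀ q₀ : L2) : Set Path :=
  {γ | MemH2 γ.q ∧ (∀ t ∈ Icc (0 : ℝ) 1, γ.q t ∈ Q ∧ γ.p t ∈ cotangent (γ.q t)) ∧
    FirstEquation γ ∧ γ.q 0 = q₀ ∧ γ.p 0 = p₀}

/-- The curves as in `curves0`, with in addition `q(1) = q₁` and `p(1) = p₁`. -/
def curves01 (p₀ q₀ p₁ q₁ : L2) : Set Path :=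
  {γ | γ ∈ curves0 p₀ q₀ ∧ γ.q 1 = q₁ ∧ γ.p 1 = p₁}

/-- `(D/Dt q̇)^♭ = ṗ + 𝒰(p², q) - π₁(p, q) - π₂(q, p²)` at time `t`: the covariant acceleration of
the curve in `Q`, as a covector. -/
def acceleration (γ : Path) (t x : ℝ) : ℝ :=
  (derivWithin γ.p (Icc 0 1) t : L2) x + nonlocal (fun y => (γ.p t y) ^ 2) (γ.q t) x
    - proj1 (γ.p t) (γ.q t) x - proj2 (γ.q t) (fun y => (γ.p t y) ^ 2) x

/-- The geodesic equation on `Q` in Hamiltonian form: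
`q̇ = η(q) p`, `ṗ = -𝒰(p², q) + π₁(p, q) + π₂(q, p²)` on `[0,1]`. -/
def IsGeodesic (γ : Path) : Prop :=
  FirstEquation γ ∧
  ∀ t ∈ Icc (0 : ℝ) 1, ∃ r : L2, HasDerivWithinAt γ.p r (Icc 0 1) t ∧
    r =ᵐ[volume.restrict (Icc (0 : ℝ) 1)] fun x =>
      -nonlocal (fun y => (γ.p t y) ^ 2) (γ.q t) x + proj1 (γ.p t) (γ.q t) x
        + proj2 (γ.q t) (fun y => (γ.p t y) ^ 2) x

/-! ### The Fisher-Rao functional -/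

/-- The space-time domain, with variables `(t, x)`. -/
def D : Set (ℝ × ℝ) := Icc (0 : ℝ) 1 ×ˢ Icc (0 : ℝ) 1

/-- The one-homogeneous convex function `r(x, y) = y² / (4x)`. -/
def frDensity (x y : ℝ) : ℝ≥0∞ :=
  if 0 < x then ENNReal.ofReal (y ^ 2 / (4 * x)) else if x = 0 ∧ y = 0 then 0 else ⊤

/-- `FR_f(μ, ν) = ∫ r(dμ/dλ, dν/dλ) f dλ`, with the dominating measure `λ = μ + |ν|`; by
homogeneity of `r` the value is the same for every dominating measure. -/
def fisherRao (f : ℝ × ℝ → ℝ) (μ : Measure (ℝ × ℝ)) (ν : SignedMeasure (ℝ × ℝ)) : ℝ≥0∞ :=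
  ∫⁻ z, frDensity (μ.rnDeriv (μ + ν.totalVariation) z).toReal (ν.rnDeriv (μ + ν.totalVariation) z)
    * ENNReal.ofReal (f z) ∂(μ + ν.totalVariation)

/-- The integral of a function against a signed measure. -/
def signedIntegral (ν : SignedMeasure (ℝ × ℝ)) (f : ℝ × ℝ → ℝ) : ℝ :=
  (∫ z, f z ∂ν.toJordanDecomposition.posPart) - ∫ z, f z ∂ν.toJordanDecomposition.negPart

/-- `f ∈ C_{1,0}(D)`, with time derivative `f'`. -/
def MemC10 (f f' : ℝ × ℝ → ℝ) : Prop :=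
  ContinuousOn f D ∧ ContinuousOn f' D ∧
    ∀ t ∈ Icc (0 : ℝ) 1, ∀ x ∈ Icc (0 : ℝ) 1,
      HasDerivWithinAt (fun s => f (s, x)) (f' (t, x)) (Icc 0 1) t

/-- The signed measure `δ` on `D` is `∂_t Δ`, and `Δ` vanishes at time `0`, in the weak sense:
`⟨∂_t f, Δ⟩ + ⟨f, δ⟩ = 0` for all `f ∈ C_{1,0}(D)` with `f(1, ·) = 0`. -/
def IsTimeDerivZeroInit (Δ : Measure (ℝ × ℝ)) (δ : SignedMeasure (ℝ × ℝ)) : Prop :=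
  δ.totalVariation Dᶜ = 0 ∧
  ∀ f f' : ℝ × ℝ → ℝ, MemC10 f f' → (∀ x ∈ Icc (0 : ℝ) 1, f (1, x) = 0) →
    (∫ z, f' z ∂Δ) + signedIntegral δ f = 0

/-- `FR_f(Δ, ∂_t Δ)` for `Δ` vanishing at time `0`, and `+∞` if `Δ` does not vanish at time `0` or
`∂_t Δ` is not a measure.  (The weak equation determines `δ` except on `{t = 1}`, where `Δ` has no
mass, so that a finite value forces `δ` to vanish there.) -/
def fisherRaoTime (f : ℝ × ℝ → ℝ) (Δ : Measure (ℝ × ℝ)) : ℝ≥0∞ :=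
  ⨅ (δ : SignedMeasure (ℝ × ℝ)) (_ : IsTimeDerivZeroInit Δ δ), fisherRao f Δ δ

/-! ### The relaxed functional -/

/-- The disintegration `Δ = Δ_t dt` with respect to time.  A `Δ` with `fisherRaoTime f Δ < ∞` has a
time marginal that is absolutely continuous. -/
def slice (Δ : Measure (ℝ × ℝ)) [IsFiniteMeasure Δ] (t : ℝ) : Measure ℝ :=
  Δ.fst.rnDeriv volume t • Δ.condKernel t

/-- The relaxed acceleration functional
`ℱ(Δ, p, q) = FR_η(Δ, ∂_t Δ) + ∫₀¹ ‖(D/Dt q̇)^♭ + π_q^*(𝒰(Δ, q))‖_q² dt + P(p(1), q(1))`. -/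
def relaxedFunctional (P : L2 → L2 → ℝ) (γ : Path)
    (Δ : Measure (ℝ × ℝ)) [IsFiniteMeasure Δ] : EReal :=
  ((fisherRaoTime (fun z => eta (γ.q z.1) z.2) Δ
    + ∫⁻ t in Icc (0 : ℝ) 1, ∫⁻ x in Icc (0 : ℝ) 1, ENNReal.ofReal
        (eta (γ.q t) x *
          (acceleration γ t x
            + projStar (γ.q t) (nonlocalMeas (slice Δ t) (γ.q t)) x) ^ 2) : ℝ≥0∞) : EReal)
  + ((P (γ.p 1) (γ.q 1) : ℝ) : EReal)

/-- `ℱ(·, p, q)` is minimal at `Δ = 0` among the finite positive measures on `D` (those that do not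
vanish at time `0` have `ℱ = +∞`). -/
def OptimalAtZero (P : L2 → L2 → ℝ) (γ : Path) : Prop :=
  ∀ (Δ : Measure (ℝ × ℝ)) [IsFiniteMeasure Δ], Δ Dᶜ = 0 →
    relaxedFunctional P γ 0 ≤ relaxedFunctional P γ Δ

/-! ### The `C²([0,1], L²([0,1]))` topology -/

/-- The curves that are `C²` on `[0,1]` with values in `L²([0,1])`. -/
def C2Curve : Type := {q : ℝ → L2 // ContDiffOn ℝ 2 q (Icc 0 1)}

/-- The derivatives of order `0, 1, 2`, as continuous functions on `[0,1]`. -/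
def C2Curve.jet (q : C2Curve) (k : Fin 3) : C(Icc (0 : ℝ) 1, L2) where
  toFun t := iteratedDerivWithin k q.1 (Icc 0 1) t
  continuous_toFun := by
    have h : ContinuousOn (iteratedDerivWithin (k : ℕ) q.1 (Icc (0 : ℝ) 1)) (Icc 0 1) :=
      q.2.continuousOn_iteratedDerivWithin (by
        have : (k : ℕ) ≤ 2 := by omega
        exact_mod_cast this) (uniqueDiffOn_Icc zero_lt_one)
    exact continuousOn_iff_continuous_domRestrict.1 h

/-- The `C²` topology: uniform convergence on `[0,1]` of the derivatives of order `0, 1, 2`. -/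
instance : TopologicalSpace C2Curve := TopologicalSpace.induced C2Curve.jet inferInstance

/-- `S` contains an open neighborhood of `γ` in the set of curves `C`, for the `C²` topology. -/
def ContainsC2Neighborhood (C S : Set Path) (γ : Path) : Prop :=
  ∃ (h : ContDiffOn ℝ 2 γ.q (Icc 0 1)) (U : Set C2Curve), IsOpen U ∧ (⟨γ.q, h⟩ : C2Curve) ∈ U ∧
    ∀ γ' ∈ C, ∀ h' : ContDiffOn ℝ 2 γ'.q (Icc 0 1), (⟨γ'.q, h'⟩ : C2Curve) ∈ U → γ' ∈ S

end

end DiffSpline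

/-!
Along a geodesic the covariant acceleration vanishes, so along a curve that is `C²`-close to it the
acceleration is small in `L²`, uniformly in time. Adding `π_q^*(𝒰(Δ_t, q))` to a small
acceleration lowers its squared norm by at most a small multiple of the mass of `Δ_t`: the square of
the added term only helps, and the cross term is bounded by its supremum norm, which is linear in
that mass. On the other hand, testing `∂_tΔ` against `(1 - t) / 2` and using that the density
`r(x, y) = y² / 4x` dominates its tangents `y a - x a²` gives `FR_η(Δ, ∂_tΔ) ≥ (min η / 4) Δ(D)`,
so the Fisher-Rao term outweighs any gain.

The acceleration depends continuously on the two-jet of the curve, because `p = η(-q) ∂_t q` and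
because `η`, `φ`, `𝒰`, `π₁`, `π₂` are built from exponentials, products and primitives in the Banach
algebra of bounded continuous functions. The same description shows that geodesics are `C²`.
-/

open scoped BoundedContinuousFunction

namespace DiffSpline

noncomputable section

section SignedMeasure

variable {α E : Type*} [MeasurableSpace α] {l : Measure α}

theorem ofReal_integral_le_lintegral_ofReal {g : α → ℝ} (hg : Integrable g l) :
    ENNReal.ofReal (∫ z, g z ∂l) ≤ ∫⁻ z, ENNReal.ofReal (g z) ∂l := by
  refine ENNReal.ofReal_le_of_le_toReal ?_
  rw [integral_eq_lintegral_pos_part_sub_lintegral_neg_part hg]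
  exact sub_le_self _ ENNReal.toReal_nonneg

variable [NormedAddCommGroup E] [NormedSpace ℝ E] {s : SignedMeasure α} {f : α → E}

theorem rnDeriv_smul_eq_sub (s : SignedMeasure α) (l : Measure α) (f : α → E) :
    (fun z => s.rnDeriv l z • f z) = fun z =>
      (s.toJordanDecomposition.posPart.rnDeriv l z).toReal • f z -
        (s.toJordanDecomposition.negPart.rnDeriv l z).toReal • f z := by
  funext z
  rw [SignedMeasure.rnDeriv_def, sub_smul]

variable [SigmaFinite l]

theorem integrable_signed_rnDeriv_smul (hs : s.totalVariation ≪ l)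
    (hf : Integrable f s.totalVariation) : Integrable (fun z => s.rnDeriv l z • f z) l := by
  obtain ⟨hpos, hneg⟩ := (SignedMeasure.totalVariation_absolutelyContinuous_iff _ _).1 hs
  obtain ⟨hfpos, hfneg⟩ := integrable_add_measure.1 hf
  rw [rnDeriv_smul_eq_sub]
  exact ((integrable_rnDeriv_smul_iff hpos).2 hfpos).sub
    ((integrable_rnDeriv_smul_iff hneg).2 hfneg)

theorem integral_signed_rnDeriv_smul (hs : s.totalVariation ≪ l)
    (hf : Integrable f s.totalVariation) :
    ∫ z, s.rnDeriv l z • f z ∂l =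
      ∫ z, f z ∂s.toJordanDecomposition.posPart - ∫ z, f z ∂s.toJordanDecomposition.negPart := by
  obtain ⟨hpos, hneg⟩ := (SignedMeasure.totalVariation_absolutelyContinuous_iff _ _).1 hs
  obtain ⟨hfpos, hfneg⟩ := integrable_add_measure.1 hf
  rw [rnDeriv_smul_eq_sub, integral_sub ((integrable_rnDeriv_smul_iff hpos).2 hfpos)
    ((integrable_rnDeriv_smul_iff hneg).2 hfneg), integral_rnDeriv_smul hpos,
    integral_rnDeriv_smul hneg]

end SignedMeasure

section FisherRao

theorem ofReal_tangent_le_frDensity (a x y : ℝ) :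
    ENNReal.ofReal (y * a - x * a ^ 2) ≤ frDensity x y := by
  unfold frDensity
  split_ifs with hx hxy
  · refine ENNReal.ofReal_le_ofReal ?_
    rw [le_div_iff₀ (by positivity)]
    nlinarith [sq_nonneg (y - 2 * a * x)]
  · simp [hxy.1, hxy.2]
  · exact le_top

theorem ofReal_mul_fisherRao_one_le {μ : Measure (ℝ × ℝ)} {ν : SignedMeasure (ℝ × ℝ)}
    {f : ℝ × ℝ → ℝ} {m : ℝ} (hf : ∀ᵐ z ∂(μ + ν.totalVariation), m ≤ f z) :
    ENNReal.ofReal m * fisherRao 1 μ ν ≤ fisherRao f μ ν := by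
  unfold fisherRao
  rw [mul_comm, ← lintegral_mul_const' _ _ ENNReal.ofReal_ne_top]
  refine lintegral_mono_ae (hf.mono fun z hz => ?_)
  rw [Pi.one_apply, ENNReal.ofReal_one, mul_one]
  gcongr

theorem ofReal_signedIntegral_sub_le_fisherRao_one {μ : Measure (ℝ × ℝ)} [IsFiniteMeasure μ]
    {ν : SignedMeasure (ℝ × ℝ)} {a : ℝ × ℝ → ℝ} (ha : Integrable a ν.totalVariation)
    (ha2 : Integrable (fun z => a z ^ 2) μ) :
    ENNReal.ofReal (signedIntegral ν a - ∫ z, a z ^ 2 ∂μ) ≤ fisherRao 1 μ ν := by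
  set l := μ + ν.totalVariation
  have : IsFiniteMeasure l := isFiniteMeasureAdd
  have : SFinite μ := inferInstance
  have hμ : μ ≪ l := Measure.absolutelyContinuous_of_le (Measure.le_add_right le_rfl)
  have hν : ν.totalVariation ≪ l := Measure.absolutelyContinuous_of_le (Measure.le_add_left le_rfl)
  have hint := integrable_signed_rnDeriv_smul hν ha
  have hint2 := (integrable_rnDeriv_smul_iff hμ).2 ha2
  calc ENNReal.ofReal (signedIntegral ν a - ∫ z, a z ^ 2 ∂μ)
      = ENNReal.ofReal (∫ z, (ν.rnDeriv l z • a z - (μ.rnDeriv l z).toReal • a z ^ 2) ∂l) := by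
        rw [integral_sub hint hint2, integral_signed_rnDeriv_smul hν ha, integral_rnDeriv_smul hμ,
          signedIntegral]
    _ ≤ ∫⁻ z, ENNReal.ofReal (ν.rnDeriv l z • a z - (μ.rnDeriv l z).toReal • a z ^ 2) ∂l :=
        ofReal_integral_le_lintegral_ofReal (hint.sub hint2)
    _ ≤ fisherRao 1 μ ν := lintegral_mono fun z => by
        simpa only [Pi.one_apply, ENNReal.ofReal_one, mul_one, smul_eq_mul]
          using ofReal_tangent_le_frDensity (a z) (μ.rnDeriv l z).toReal (ν.rnDeriv l z)

theorem ae_mem_D {μ : Measure (ℝ × ℝ)} (hμ : μ Dᶜ = 0) : ∀ᵐ z ∂μ, z ∈ D := ae_iff.2 hμ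

theorem integrable_of_continuousOn_D {μ : Measure (ℝ × ℝ)} [IsFiniteMeasure μ] (hμ : μ Dᶜ = 0)
    {f : ℝ × ℝ → ℝ} (hf : ContinuousOn f D) : Integrable f μ := by
  rw [← Measure.restrict_eq_self_of_ae_mem (ae_mem_D hμ)]
  exact hf.integrableOn_compact (isCompact_Icc.prod isCompact_Icc)

variable {Δ : Measure (ℝ × ℝ)}

theorem IsTimeDerivZeroInit.signedIntegral_mul_one_sub {δ : SignedMeasure (ℝ × ℝ)}
    (hδ : IsTimeDerivZeroInit Δ δ) (c : ℝ) :
    signedIntegral δ (fun z => c * (1 - z.1)) = c * Δ.real univ := by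
  have htest : (∫ _, -c ∂Δ) + signedIntegral δ (fun z => c * (1 - z.1)) = 0 := by
    refine hδ.2 _ (fun _ => -c) ⟨by fun_prop, continuousOn_const, fun t _ x _ => ?_⟩ (by simp)
    simpa using (((hasDerivAt_id t).const_sub 1).const_mul c).hasDerivWithinAt
  rw [integral_const, smul_eq_mul] at htest
  linarith

variable [IsFiniteMeasure Δ]

theorem mass_div_four_le_fisherRao_one (hΔ : Δ Dᶜ = 0) {δ : SignedMeasure (ℝ × ℝ)}
    (hδ : IsTimeDerivZeroInit Δ δ) : ENNReal.ofReal (Δ.real univ / 4) ≤ fisherRao 1 Δ δ := by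
  -- Among the test functions `c (1 - t)` the constant `c = 1 / 2` maximises `c - c ^ 2`.
  have hint : Integrable (fun z : ℝ × ℝ => (1 / 2 * (1 - z.1)) ^ 2) Δ :=
    integrable_of_continuousOn_D hΔ (by fun_prop)
  have hsq : ∫ z, (1 / 2 * (1 - z.1)) ^ 2 ∂Δ ≤ Δ.real univ * (1 / 4) := by
    rw [← smul_eq_mul, ← integral_const]
    refine integral_mono_ae hint (integrable_const _) ((ae_mem_D hΔ).mono ?_)
    rintro z ⟨⟨h0, h1⟩, -⟩
    nlinarith
  refine le_trans (ENNReal.ofReal_le_ofReal ?_) (ofReal_signedIntegral_sub_le_fisherRao_one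
    (integrable_of_continuousOn_D hδ.1 (by fun_prop)) hint)
  rw [hδ.signedIntegral_mul_one_sub]
  linarith

theorem ofReal_mul_mass_le_fisherRaoTime (hΔ : Δ Dᶜ = 0) {f : ℝ × ℝ → ℝ} {m : ℝ} (hm : 0 ≤ m)
    (hf : ∀ z ∈ D, m ≤ f z) : ENNReal.ofReal (m / 4) * Δ univ ≤ fisherRaoTime f Δ := by
  refine le_iInf₂ fun δ hδ => ?_
  calc ENNReal.ofReal (m / 4) * Δ univ = ENNReal.ofReal m * ENNReal.ofReal (Δ.real univ / 4) := by
        rw [← ENNReal.ofReal_mul hm, ← ofReal_measureReal, ← ENNReal.ofReal_mul (by positivity),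
          div_mul_eq_mul_div, mul_div_assoc]
    _ ≤ ENNReal.ofReal m * fisherRao 1 Δ δ := by
        gcongr
        exact mass_div_four_le_fisherRao_one hΔ hδ
    _ ≤ fisherRao f Δ δ := ofReal_mul_fisherRao_one_le <|
        (ae_mem_D (by simp [hΔ, hδ.1])).mono hf

theorem fisherRaoTime_zero (f : ℝ × ℝ → ℝ) : fisherRaoTime f 0 = 0 := by
  have hderiv : IsTimeDerivZeroInit 0 0 := by
    refine ⟨by simp [SignedMeasure.totalVariation_zero], fun f f' _ _ => ?_⟩
    simp [signedIntegral, SignedMeasure.toJordanDecomposition_zero]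
  refine le_antisymm ((iInf₂_le 0 hderiv).trans_eq ?_) zero_le
  simp [fisherRao, SignedMeasure.totalVariation_zero]

end FisherRao

section Slice

theorem slice_zero_ae : ∀ᵐ t : ℝ, slice (0 : Measure (ℝ × ℝ)) t = 0 := by
  filter_upwards [Measure.rnDeriv_zero (volume : Measure ℝ)] with t ht
  simp [slice, ht]

variable (Δ : Measure (ℝ × ℝ)) [IsFiniteMeasure Δ]

theorem slice_univ (t : ℝ) : slice Δ t univ = Δ.fst.rnDeriv volume t := by
  simp [slice]

theorem measurable_slice_univ : Measurable fun t => slice Δ t univ := by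
  simpa only [slice_univ] using Measure.measurable_rnDeriv _ _

theorem slice_univ_lt_top : ∀ᵐ t : ℝ, slice Δ t univ < ∞ := by
  simpa only [slice_univ] using Measure.rnDeriv_lt_top _ _

theorem setLIntegral_slice_univ_le (s : Set ℝ) : ∫⁻ t in s, slice Δ t univ ≤ Δ univ := by
  simp only [slice_univ]
  exact (Measure.setLIntegral_rnDeriv_le s).trans
    ((measure_mono (subset_univ s)).trans_eq Measure.fst_univ)

end Slice

section Bounds

theorem eta_pos (q : L2) (x : ℝ) : 0 < eta q x := Real.exp_pos _

theorem abs_eta (q : L2) (x : ℝ) : |eta q x| = eta q x := abs_of_pos (eta_pos q x)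

theorem H2_inv : H2⁻¹ = !![4, -6; -6, 12] := by
  refine Matrix.inv_eq_right_inv ?_
  ext i j
  fin_cases i <;> fin_cases j <;> norm_num [H2, Matrix.mul_apply]

theorem lift_eq (q : L2) (α β x : ℝ) :
    lift q α β x = (4 * α - 6 * β) + (12 * β - 6 * α) * phi q x := by
  simp only [lift, H2_inv, Matrix.mulVec, dotProduct, Fin.sum_univ_two, Matrix.cons_val_zero,
    Matrix.cons_val_one, Matrix.of_apply]
  ring

theorem abs_lift_le (q : L2) (α β x : ℝ) :
    |lift q α β x| ≤ (4 * |α| + 6 * |β|) + (12 * |β| + 6 * |α|) * |phi q x| := by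
  have habs_sub (a b : ℝ) {c d : ℝ} (hc : 0 ≤ c) (hd : 0 ≤ d) :
      |c * a - d * b| ≤ c * |a| + d * |b| := by
    simpa only [abs_mul, abs_of_nonneg hc, abs_of_nonneg hd] using abs_sub (c * a) (d * b)
  rw [lift_eq]
  refine (abs_add_le _ _).trans ?_
  rw [abs_mul]
  gcongr <;> exact habs_sub _ _ (by norm_num) (by norm_num)

theorem abs_intervalIntegral_le_of_abs_le {g : ℝ → ℝ} {A x : ℝ} (hx : x ∈ Icc (0 : ℝ) 1)
    (hg : ∀ y ∈ Icc (0 : ℝ) 1, |g y| ≤ A) : |∫ y in (0 : ℝ)..x, g y| ≤ A := by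
  have hA : 0 ≤ A := (abs_nonneg _).trans (hg x hx)
  calc |∫ y in (0 : ℝ)..x, g y| ≤ A * |x - 0| := by
        rw [← Real.norm_eq_abs]
        refine intervalIntegral.norm_integral_le_of_norm_le_const fun y hy => ?_
        rw [uIoc_of_le hx.1] at hy
        exact hg y ⟨hy.1.le, hy.2.trans hx.2⟩
    _ ≤ A := by
        rw [sub_zero, abs_of_nonneg hx.1]
        exact mul_le_of_le_one_right hA hx.2

variable {q : L2} {E x : ℝ}

theorem abs_nonlocalMeas_le {m : Measure ℝ} [IsFiniteMeasure m]
    (hE : ∀ y ∈ Icc (0 : ℝ) 1, eta q y ≤ E) (hx : x ∈ Icc (0 : ℝ) 1) :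
    |nonlocalMeas m q x| ≤ E / 2 * m.real univ := by
  have hE0 : 0 ≤ E := (eta_pos q x).le.trans (hE x hx)
  calc |nonlocalMeas m q x| = 1 / 2 * ‖∫ y in Icc x 1, eta q y ∂m‖ := by
        rw [nonlocalMeas, abs_mul, abs_of_pos one_half_pos, Real.norm_eq_abs]
    _ ≤ 1 / 2 * (E * m.real (Icc x 1)) := by
        gcongr
        refine norm_setIntegral_le_of_norm_le_const (measure_lt_top _ _) fun y hy => ?_
        rw [Real.norm_eq_abs, abs_eta]
        exact hE y ⟨hx.1.trans hy.1, hy.2⟩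
    _ ≤ 1 / 2 * (E * m.real univ) := by
        gcongr
        exacts [measure_ne_top m univ, subset_univ _]
    _ = E / 2 * m.real univ := by ring

theorem abs_phi_le (hE : ∀ y ∈ Icc (0 : ℝ) 1, eta q y ≤ E) (hx : x ∈ Icc (0 : ℝ) 1) :
    |phi q x| ≤ E :=
  abs_intervalIntegral_le_of_abs_le hx fun y hy => (abs_eta q y).trans_le (hE y hy)

/-- A bound on the norm of `π_q^*` for the supremum norm on `[0,1]`, in terms of an upper bound `E`
for `η(q)`. -/
def projStarBound (E : ℝ) : ℝ := 1 + 4 * E + 12 * E ^ 2 + 12 * E ^ 3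

theorem abs_projStar_le {f : ℝ → ℝ} {A : ℝ} (hE : ∀ y ∈ Icc (0 : ℝ) 1, eta q y ≤ E)
    (hf : ∀ y ∈ Icc (0 : ℝ) 1, |f y| ≤ A) (hx : x ∈ Icc (0 : ℝ) 1) :
    |projStar q f x| ≤ A * projStarBound E := by
  have hA : 0 ≤ A := (abs_nonneg _).trans (hf x hx)
  have hE0 : 0 ≤ E := (eta_pos q x).le.trans (hE x hx)
  have hηf (y : ℝ) (hy : y ∈ Icc (0 : ℝ) 1) : |eta q y * f y| ≤ E * A := by
    rw [abs_mul, abs_eta]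
    gcongr
    exacts [hE y hy, hf y hy]
  have hηfφ (y : ℝ) (hy : y ∈ Icc (0 : ℝ) 1) : |eta q y * f y * phi q y| ≤ E * A * E := by
    rw [abs_mul]
    gcongr
    exacts [hηf y hy, abs_phi_le hE hy]
  have hα : |∫ y in (0 : ℝ)..1, eta q y * f y| ≤ E * A :=
    abs_intervalIntegral_le_of_abs_le unitInterval.one_mem hηf
  have hβ : |∫ y in (0 : ℝ)..1, eta q y * f y * phi q y| ≤ E * A * E :=
    abs_intervalIntegral_le_of_abs_le unitInterval.one_mem hηfφ
  calc |projStar q f x| ≤ |f x| + _ := abs_sub _ _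
    _ ≤ A + ((4 * (E * A) + 6 * (E * A * E)) + (12 * (E * A * E) + 6 * (E * A)) * E) := by
        refine add_le_add (hf x hx) ((abs_lift_le _ _ _ _).trans ?_)
        gcongr
        exact abs_phi_le hE hx
    _ = A * projStarBound E := by rw [projStarBound]; ring

end Bounds

section IntervalIntegral

variable {E : Type*} [NormedAddCommGroup E] [NormedSpace ℝ E] {μ : Measure ℝ} {s : Set ℝ}
  [OrdConnected s] {f g : ℝ → E} {a b : ℝ}

theorem intervalIntegral_restrict (ha : a ∈ s) (hb : b ∈ s) :
    ∫ y in a..b, f y ∂μ.restrict s = ∫ y in a..b, f y ∂μ := by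
  have hs : uIoc a b ⊆ s := uIoc_subset_uIcc.trans (OrdConnected.uIcc_subset ‹_› ha hb)
  simp only [intervalIntegral.intervalIntegral_eq_integral_uIoc,
    Measure.restrict_restrict measurableSet_uIoc, inter_eq_left.2 hs]

theorem intervalIntegral_congr_ae_restrict (hfg : f =ᵐ[μ.restrict s] g) (ha : a ∈ s) (hb : b ∈ s) :
    ∫ y in a..b, f y ∂μ = ∫ y in a..b, g y ∂μ := by
  rw [← intervalIntegral_restrict (f := f) ha hb, ← intervalIntegral_restrict (f := g) ha hb]
  exact intervalIntegral.integral_congr_ae_restrict (ae_restrict_of_ae hfg)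

variable (μ)

theorem norm_integral_Lp_one_le (f : Lp E 1 μ) (a b : ℝ) : ‖∫ y in a..b, f y ∂μ‖ ≤ ‖f‖ := by
  refine intervalIntegral.norm_integral_le_integral_norm_uIoc.trans ?_
  rw [L1.norm_eq_integral_norm]
  exact setIntegral_le_integral (L1.integrable_coeFn f).norm (.of_forall fun _ => norm_nonneg _)

variable [NullSingletonClass μ]

/-- The primitive `x ↦ ∫₀ˣ f` of an integrable function, as a bounded continuous function. -/
def primitiveL1 : Lp E 1 μ →L[ℝ] ℝ →ᵇ E :=
  have hint (f : Lp E 1 μ) (a b : ℝ) : IntervalIntegrable f μ a b :=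
    (L1.integrable_coeFn f).intervalIntegrable
  LinearMap.mkContinuous
    { toFun f := .ofNormedAddCommGroup (fun x => ∫ y in (0 : ℝ)..x, f y ∂μ)
        (intervalIntegral.continuous_primitive (hint f) 0) ‖f‖ (norm_integral_Lp_one_le μ f 0)
      map_add' f g := by
        ext x
        refine (intervalIntegral.integral_congr_ae ?_).trans
          (intervalIntegral.integral_add (hint f 0 x) (hint g 0 x))
        exact (Lp.coeFn_add f g).mono fun _ hx _ => hx
      map_smul' c f := by
        ext x
        refine (intervalIntegral.integral_congr_ae ?_).trans (intervalIntegral.integral_smul c _)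
        exact (Lp.coeFn_smul c f).mono fun _ hx _ => hx }
    1 fun f => by
      rw [one_mul]
      exact (BoundedContinuousFunction.norm_le (norm_nonneg _)).2 (norm_integral_Lp_one_le μ f 0)

end IntervalIntegral

theorem exp_bounded_apply {X : Type*} [TopologicalSpace X] (f : X →ᵇ ℝ) (x : X) :
    NormedSpace.exp f x = Real.exp (f x) := by
  rw [Real.exp_eq_exp_ℝ]
  exact NormedSpace.map_exp ((ContinuousMap.evalAlgHom ℝ ℝ x).comp
    (BoundedContinuousFunction.toContinuousMapₐ ℝ))
    (BoundedContinuousFunction.evalCLM ℝ x).continuous f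

section Operators

/-- Lebesgue measure on `[0,1]`, with respect to which the elements of `L2` are classes of
functions. -/
abbrev unitMeasure : Measure ℝ := volume.restrict (Icc (0 : ℝ) 1)

instance : IsProbabilityMeasure unitMeasure := ⟨by simp⟩

theorem ae_unitMeasure {p : ℝ → Prop} (h : ∀ x ∈ Icc (0 : ℝ) 1, p x) : ∀ᵐ x ∂unitMeasure, p x :=
  (ae_restrict_mem measurableSet_Icc).mono h

theorem lintegral_enorm_le (f : L2) : ∫⁻ x, ‖f x‖ₑ ∂unitMeasure ≤ ENNReal.ofReal ‖f‖ := by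
  rw [ofReal_norm, Lp.enorm_def, ← eLpNorm_one_eq_lintegral_enorm]
  exact eLpNorm_le_eLpNorm_of_exponent_le one_le_two (Lp.aestronglyMeasurable f)

theorem abs_intervalIntegral_le_norm (f : L2) {x : ℝ} (hx : x ∈ Icc (0 : ℝ) 1) :
    |∫ y in (0 : ℝ)..x, f y| ≤ ‖f‖ := by
  have hL1 : ∫ y, ‖f y‖ ∂unitMeasure ≤ ‖f‖ := by
    rw [integral_norm_eq_lintegral_enorm (Lp.aestronglyMeasurable f)]
    exact ENNReal.toReal_le_of_le_ofReal (norm_nonneg f) (lintegral_enorm_le f)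
  rw [← Real.norm_eq_abs, ← intervalIntegral_restrict unitInterval.zero_mem hx]
  refine le_trans intervalIntegral.norm_integral_le_integral_norm_uIoc (le_trans ?_ hL1)
  exact setIntegral_le_integral ((Lp.memLp f).integrable one_le_two).norm
    (.of_forall fun _ => norm_nonneg _)

theorem eta_mem_Icc {q : L2} {K x : ℝ} (hK : ‖q‖ ≤ K) (hx : x ∈ Icc (0 : ℝ) 1) :
    eta q x ∈ Icc (Real.exp K)⁻¹ (Real.exp K) := by
  have hq := abs_le.1 ((abs_intervalIntegral_le_norm q hx).trans hK)
  rw [← Real.exp_neg]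
  exact ⟨Real.exp_le_exp.2 hq.1, Real.exp_le_exp.2 hq.2⟩

/-- The inclusion of the bounded continuous functions in `L²([0,1])`. -/
def toL2 : (ℝ →ᵇ ℝ) →L[ℝ] L2 := BoundedContinuousFunction.toLp 2 unitMeasure ℝ

theorem coeFn_toL2 (f : ℝ →ᵇ ℝ) : toL2 f =ᵐ[unitMeasure] f :=
  BoundedContinuousFunction.coeFn_toLp 2 unitMeasure ℝ f

/-- Multiplication of a square integrable function by a bounded continuous one. -/
def mulL2 : (ℝ →ᵇ ℝ) →L[ℝ] L2 →L[ℝ] L2 :=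
  ((ContinuousLinearMap.mul ℝ ℝ).holderL unitMeasure ∞ 2 2).comp
    (BoundedContinuousFunction.toLp ∞ unitMeasure ℝ)

theorem coeFn_mulL2 (f : ℝ →ᵇ ℝ) (g : L2) : mulL2 f g =ᵐ[unitMeasure] fun x => f x * g x := by
  filter_upwards [(ContinuousLinearMap.mul ℝ ℝ).coeFn_holder (r := 2)
    (BoundedContinuousFunction.toLp ∞ unitMeasure ℝ f) g,
    BoundedContinuousFunction.coeFn_toLp ∞ unitMeasure ℝ f] with x hmul hf
  rw [← hf]
  exact hmul

/-- The primitive of the product of two square integrable functions. -/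
def primitiveMul : L2 →L[ℝ] L2 →L[ℝ] ℝ →ᵇ ℝ :=
  ((primitiveL1 unitMeasure).postcomp L2).comp
    ((ContinuousLinearMap.mul ℝ ℝ).holderL unitMeasure 2 2 1)

theorem primitiveMul_apply (f g : L2) {x : ℝ} (hx : x ∈ Icc (0 : ℝ) 1) :
    primitiveMul f g x = ∫ y in (0 : ℝ)..x, f y * g y := by
  rw [← intervalIntegral_restrict unitInterval.zero_mem hx]
  exact intervalIntegral.integral_congr_ae
    (((ContinuousLinearMap.mul ℝ ℝ).coeFn_holder (r := 1) f g).mono fun _ h _ => h)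

theorem primitiveMul_one_sub (f g : L2) {x : ℝ} (hx : x ∈ Icc (0 : ℝ) 1) :
    primitiveMul f g 1 - primitiveMul f g x = ∫ y in x..1, f y * g y := by
  have hint (a b : ℝ) : IntervalIntegrable (fun y => f y * g y) unitMeasure a b :=
    ((Lp.memLp f).integrable_mul (Lp.memLp g)).intervalIntegrable
  rw [primitiveMul_apply f g unitInterval.one_mem, primitiveMul_apply f g hx,
    ← intervalIntegral_restrict unitInterval.zero_mem unitInterval.one_mem,
    ← intervalIntegral_restrict unitInterval.zero_mem hx,
    ← intervalIntegral_restrict hx unitInterval.one_mem,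
    intervalIntegral.integral_interval_sub_left (hint _ _) (hint _ _)]

/-- The primitive of a square integrable function. -/
def primitiveL2 : L2 →L[ℝ] ℝ →ᵇ ℝ := primitiveMul (toL2 1)

theorem primitiveL2_apply (f : L2) {x : ℝ} (hx : x ∈ Icc (0 : ℝ) 1) :
    primitiveL2 f x = ∫ y in (0 : ℝ)..x, f y := by
  refine (primitiveMul_apply _ _ hx).trans
    (intervalIntegral_congr_ae_restrict ?_ unitInterval.zero_mem hx)
  filter_upwards [coeFn_toL2 1] with y hy
  rw [hy]
  exact one_mul _

theorem primitiveL2_apply_of_ae_eq {f : L2} {g : ℝ → ℝ} (h : f =ᵐ[unitMeasure] g) {x : ℝ}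
    (hx : x ∈ Icc (0 : ℝ) 1) : primitiveL2 f x = ∫ y in (0 : ℝ)..x, g y :=
  (primitiveL2_apply f hx).trans
    (intervalIntegral_congr_ae_restrict h unitInterval.zero_mem hx)

theorem primitiveL2_toL2_apply {f : ℝ →ᵇ ℝ} {g : ℝ → ℝ} (h : EqOn f g (Icc 0 1)) {x : ℝ}
    (hx : x ∈ Icc (0 : ℝ) 1) : primitiveL2 (toL2 f) x = ∫ y in (0 : ℝ)..x, g y :=
  primitiveL2_apply_of_ae_eq ((coeFn_toL2 f).trans (ae_unitMeasure h)) hx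

/-- The integral over `[0,1]` of a bounded continuous function. -/
def unitIntegral : (ℝ →ᵇ ℝ) →L[ℝ] ℝ :=
  (BoundedContinuousFunction.evalCLM ℝ 1).comp (primitiveL2.comp toL2)

theorem unitIntegral_eq {f : ℝ →ᵇ ℝ} {g : ℝ → ℝ} (h : EqOn f g (Icc 0 1)) :
    unitIntegral f = ∫ x in (0 : ℝ)..1, g x :=
  primitiveL2_toL2_apply h unitInterval.one_mem

end Operators

section Velocity

/-- `η(q)` as a bounded continuous function. -/
def etaBCF (q : L2) : ℝ →ᵇ ℝ := NormedSpace.exp (primitiveL2 q)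

theorem etaBCF_eqOn (q : L2) : EqOn (etaBCF q) (eta q) (Icc 0 1) := fun x hx => by
  rw [etaBCF, exp_bounded_apply, primitiveL2_apply q hx, eta]

theorem contDiff_etaBCF {n : WithTop ℕ∞} : ContDiff ℝ n etaBCF :=
  (contDiff_iff_contDiffAt.2 fun _ => (NormedSpace.exp_analytic _).contDiffAt).comp
    primitiveL2.contDiff

/-- The vector `η(q) p` that corresponds to the covector `p` at `q`, as a function of `(q, p)`. -/
def velocity (z : L2 × L2) : L2 := mulL2 (etaBCF z.1) z.2

theorem coeFn_velocity (q p : L2) : velocity (q, p) =ᵐ[unitMeasure] fun x => eta q x * p x := by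
  filter_upwards [coeFn_mulL2 (etaBCF q) p, ae_unitMeasure (etaBCF_eqOn q)] with x hmul heta
  rw [velocity, hmul, heta]

theorem contDiff_velocity {n : WithTop ℕ∞} : ContDiff ℝ n velocity :=
  (mulL2.contDiff.comp (contDiff_etaBCF.comp contDiff_fst)).clm_apply contDiff_snd

theorem eta_neg (q : L2) {x : ℝ} (hx : x ∈ Icc (0 : ℝ) 1) : eta (-q) x = (eta q x)⁻¹ := by
  rw [eta, eta, ← Real.exp_neg, ← primitiveL2_apply _ hx, ← primitiveL2_apply _ hx, map_neg,
    BoundedContinuousFunction.neg_apply]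

theorem velocity_neg_velocity (q p : L2) : velocity (-q, velocity (q, p)) = p := by
  refine Lp.ext ?_
  filter_upwards [coeFn_velocity (-q) (velocity (q, p)), coeFn_velocity q p,
    ae_unitMeasure fun x hx => eta_neg q hx] with x hneg hvel heta
  rw [hneg, hvel, heta, inv_mul_cancel_left₀ (eta_pos q x).ne']

end Velocity

section Christoffel

/-- `φ(q)` as a bounded continuous function. -/
def phiBCF (q : L2) : ℝ →ᵇ ℝ := primitiveL2 (toL2 (etaBCF q))

theorem phiBCF_eqOn (q : L2) : EqOn (phiBCF q) (phi q) (Icc 0 1) := fun _ hx =>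
  primitiveL2_toL2_apply (etaBCF_eqOn q) hx

/-- `[1 φ] H₂⁻¹ [α; β]` as a bounded continuous function. -/
def liftBCF (q : L2) (α β : ℝ) : ℝ →ᵇ ℝ :=
  (4 * α - 6 * β) • 1 + (12 * β - 6 * α) • phiBCF q

theorem liftBCF_eqOn (q : L2) (α β : ℝ) : EqOn (liftBCF q α β) (lift q α β) (Icc 0 1) :=
  fun x hx => by
    rw [lift_eq, ← phiBCF_eqOn q hx, liftBCF, BoundedContinuousFunction.add_apply,
      BoundedContinuousFunction.smul_apply, BoundedContinuousFunction.smul_apply,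
      BoundedContinuousFunction.coe_one, Pi.one_apply, smul_eq_mul, smul_eq_mul, mul_one]

/-- `𝒰(p², q)` as a bounded continuous function of `x`, in terms of `z = (q, p)`. -/
def nonlocalBCF (z : L2 × L2) : ℝ →ᵇ ℝ :=
  (1 / 2 : ℝ) • (primitiveMul (velocity z) z.2 1 • 1 - primitiveMul (velocity z) z.2)

theorem nonlocalBCF_eqOn (q p : L2) :
    EqOn (nonlocalBCF (q, p)) (nonlocal (fun y => p y ^ 2) q) (Icc 0 1) := fun x hx => by
  have hint : ∫ y in x..1, velocity (q, p) y * p y = ∫ y in x..1, eta q y * p y ^ 2 := by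
    refine intervalIntegral_congr_ae_restrict ?_ hx unitInterval.one_mem
    filter_upwards [coeFn_velocity q p] with y hy
    rw [hy, mul_assoc, sq]
  rw [nonlocal, ← hint, ← primitiveMul_one_sub _ _ hx, nonlocalBCF,
    BoundedContinuousFunction.smul_apply, BoundedContinuousFunction.sub_apply,
    BoundedContinuousFunction.smul_apply, BoundedContinuousFunction.coe_one, Pi.one_apply,
    smul_eq_mul, smul_eq_mul, mul_one]

/-- The quadratic term `𝒰(p², q) - π₁(p, q) - π₂(q, p²)` of the covariant acceleration, as a bounded
continuous function of `x`, in terms of `z = (q, p)`. -/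
def christoffel (z : L2 × L2) : ℝ →ᵇ ℝ :=
  nonlocalBCF z - liftBCF z.1 0 (3 / 2 * unitIntegral (etaBCF z.1 * primitiveL2 (velocity z) ^ 2))
    - liftBCF z.1 (unitIntegral (etaBCF z.1 * nonlocalBCF z))
        (unitIntegral (etaBCF z.1 * nonlocalBCF z * phiBCF z.1))

theorem coefB_eq (q p : L2) :
    coefB p q = 3 / 2 * unitIntegral (etaBCF q * primitiveL2 (velocity (q, p)) ^ 2) := by
  refine congrArg (3 / 2 * ·) (unitIntegral_eq fun x hx => ?_).symm
  rw [BoundedContinuousFunction.mul_apply, BoundedContinuousFunction.pow_apply, etaBCF_eqOn q hx,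
    primitiveL2_apply_of_ae_eq (coeFn_velocity q p) hx]

theorem proj2_eq (q p : L2) (x : ℝ) :
    proj2 q (fun y => p y ^ 2) x = lift q (unitIntegral (etaBCF q * nonlocalBCF (q, p)))
      (unitIntegral (etaBCF q * nonlocalBCF (q, p) * phiBCF q)) x := by
  have hmul : EqOn (etaBCF q * nonlocalBCF (q, p))
      (fun y => eta q y * nonlocal (fun y => p y ^ 2) q y) (Icc 0 1) := fun y hy =>
    congrArg₂ (· * ·) (etaBCF_eqOn q hy) (nonlocalBCF_eqOn q p hy)
  rw [proj2, projStar, sub_sub_cancel, unitIntegral_eq hmul, unitIntegral_eq fun y hy =>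
    congrArg₂ (· * ·) (hmul hy) (phiBCF_eqOn q hy)]

theorem christoffel_eqOn (q p : L2) :
    EqOn (christoffel (q, p)) (fun x => nonlocal (fun y => p y ^ 2) q x - proj1 p q x
      - proj2 q (fun y => p y ^ 2) x) (Icc 0 1) := fun x hx => by
  simp only [christoffel, BoundedContinuousFunction.sub_apply, nonlocalBCF_eqOn q p hx,
    liftBCF_eqOn q _ _ hx, proj1, coefB_eq, proj2_eq]

theorem continuous_nonlocalBCF : Continuous nonlocalBCF := by
  have hprim : Continuous fun z : L2 × L2 => primitiveMul (velocity z) z.2 :=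
    (primitiveMul.continuous.comp (contDiff_velocity (n := 0)).continuous).clm_apply continuous_snd
  unfold nonlocalBCF
  fun_prop

theorem continuous_christoffel : Continuous christoffel := by
  have hη : Continuous etaBCF := (contDiff_etaBCF (n := 0)).continuous
  have hv : Continuous velocity := (contDiff_velocity (n := 0)).continuous
  have hU : Continuous nonlocalBCF := continuous_nonlocalBCF
  unfold christoffel liftBCF phiBCF
  fun_prop

end Christoffel

section Acceleration

/-- The covariant acceleration `(D/Dt q̇)^♭` as an element of `L2`. -/
def accelerationL2 (γ : Path) (t : ℝ) : L2 :=
  derivWithin γ.p (Icc 0 1) t + toL2 (christoffel (γ.q t, γ.p t))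

theorem coeFn_accelerationL2 (γ : Path) (t : ℝ) :
    accelerationL2 γ t =ᵐ[unitMeasure] acceleration γ t := by
  filter_upwards [Lp.coeFn_add (derivWithin γ.p (Icc 0 1) t) (toL2 (christoffel (γ.q t, γ.p t))),
    coeFn_toL2 (christoffel (γ.q t, γ.p t)), ae_unitMeasure (christoffel_eqOn (γ.q t) (γ.p t))]
    with x hadd htoL2 hchristoffel
  rw [accelerationL2, hadd, Pi.add_apply, htoL2, hchristoffel, acceleration]
  ring

/-- The covariant acceleration as a function of the two-jet `z = (q, q̇, q̈)`. Since
`η(-q) = 1 / η(q)`, `p` is written as `velocity (-q, q̇)`, and `ṗ` as its time derivative. -/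
def jetAcceleration (z : L2 × L2 × L2) : L2 :=
  fderiv ℝ velocity (-z.1, z.2.1) (-z.2.1, z.2.2)
    + toL2 (christoffel (z.1, velocity (-z.1, z.2.1)))

theorem continuous_jetAcceleration : Continuous jetAcceleration := by
  have hfderiv : Continuous fun w : (L2 × L2) × (L2 × L2) => fderiv ℝ velocity w.1 w.2 :=
    contDiff_velocity.continuous_fderiv_apply one_ne_zero
  have hvelocity : Continuous velocity := (contDiff_velocity (n := 0)).continuous
  have hchristoffel : Continuous christoffel := continuous_christoffel
  exact (hfderiv.comp (f := fun z : L2 × L2 × L2 => ((-z.1, z.2.1), (-z.2.1, z.2.2)))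
    (by fun_prop)).add (by fun_prop)

variable {γ : Path} {t : ℝ}

theorem FirstEquation.hasDerivWithinAt (hγ : FirstEquation γ) (ht : t ∈ Icc (0 : ℝ) 1) :
    HasDerivWithinAt γ.q (velocity (γ.q t, γ.p t)) (Icc 0 1) t := by
  obtain ⟨v, hv, hvp⟩ := hγ t ht
  rwa [Lp.ext (hvp.trans (coeFn_velocity (γ.q t) (γ.p t)).symm)] at hv

theorem FirstEquation.p_eq (hγ : FirstEquation γ) (ht : t ∈ Icc (0 : ℝ) 1) :
    γ.p t = velocity (-γ.q t, derivWithin γ.q (Icc 0 1) t) := by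
  rw [(hγ.hasDerivWithinAt ht).derivWithin (uniqueDiffOn_Icc zero_lt_one t ht),
    velocity_neg_velocity]

theorem FirstEquation.accelerationL2_eq (hγ : FirstEquation γ)
    (hq : ContDiffOn ℝ 2 γ.q (Icc 0 1)) (ht : t ∈ Icc (0 : ℝ) 1) :
    accelerationL2 γ t = jetAcceleration (γ.q t, derivWithin γ.q (Icc 0 1) t,
      derivWithin (derivWithin γ.q (Icc 0 1)) (Icc 0 1) t) := by
  have hunique : UniqueDiffOn ℝ (Icc (0 : ℝ) 1) := uniqueDiffOn_Icc zero_lt_one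
  have hq' : HasDerivWithinAt γ.q (derivWithin γ.q (Icc 0 1) t) (Icc 0 1) t :=
    (hq.differentiableOn two_ne_zero t ht).hasDerivWithinAt
  have hq'' : HasDerivWithinAt (derivWithin γ.q (Icc 0 1))
      (derivWithin (derivWithin γ.q (Icc 0 1)) (Icc 0 1) t) (Icc 0 1) t :=
    ((hq.derivWithin (m := 1) hunique (by norm_num)).differentiableOn one_ne_zero t
      ht).hasDerivWithinAt
  have hp : HasDerivWithinAt γ.p _ (Icc 0 1) t :=
    ((contDiff_velocity.differentiable one_ne_zero _).hasFDerivAt.comp_hasDerivWithinAt t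
      (hq'.neg.prodMk hq'')).congr (fun s hs => hγ.p_eq hs) (hγ.p_eq ht)
  rw [accelerationL2, hp.derivWithin (hunique t ht), hγ.p_eq ht]
  rfl

theorem IsGeodesic.hasDerivWithinAt (hγ : IsGeodesic γ) (ht : t ∈ Icc (0 : ℝ) 1) :
    HasDerivWithinAt γ.p (-toL2 (christoffel (γ.q t, γ.p t))) (Icc 0 1) t := by
  obtain ⟨r, hr, hr_eq⟩ := hγ.2 t ht
  suffices r = -toL2 (christoffel (γ.q t, γ.p t)) by rwa [← this]
  refine Lp.ext ?_
  filter_upwards [hr_eq, Lp.coeFn_neg (toL2 (christoffel (γ.q t, γ.p t))),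
    coeFn_toL2 (christoffel (γ.q t, γ.p t)), ae_unitMeasure (christoffel_eqOn (γ.q t) (γ.p t))]
    with x hr hneg htoL2 hchristoffel
  rw [hr, hneg, Pi.neg_apply, htoL2, hchristoffel]
  ring

theorem IsGeodesic.accelerationL2_eq_zero (hγ : IsGeodesic γ) (ht : t ∈ Icc (0 : ℝ) 1) :
    accelerationL2 γ t = 0 := by
  rw [accelerationL2, (hγ.hasDerivWithinAt ht).derivWithin (uniqueDiffOn_Icc zero_lt_one t ht),
    neg_add_cancel]

theorem contDiffOn_succ_of_hasDerivWithinAt {F : Type*} [NormedAddCommGroup F] [NormedSpace ℝ F]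
    {f f' : ℝ → F} {s : Set ℝ} {n : ℕ} (hs : UniqueDiffOn ℝ s)
    (hf : ∀ x ∈ s, HasDerivWithinAt f (f' x) s x) (hf' : ContDiffOn ℝ n f' s) :
    ContDiffOn ℝ (n + 1) f s :=
  (contDiffOn_succ_iff_derivWithin hs).2 ⟨fun x hx => (hf x hx).differentiableWithinAt,
    fun h => absurd h (WithTop.coe_ne_top),
    hf'.congr fun x hx => (hf x hx).derivWithin (hs x hx)⟩

theorem IsGeodesic.contDiffOn (hγ : IsGeodesic γ) : ContDiffOn ℝ 2 γ.q (Icc 0 1) := by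
  have hunique : UniqueDiffOn ℝ (Icc (0 : ℝ) 1) := uniqueDiffOn_Icc zero_lt_one
  have hq (t) (ht : t ∈ Icc (0 : ℝ) 1) := hγ.1.hasDerivWithinAt ht
  have hp (t) (ht : t ∈ Icc (0 : ℝ) 1) := hγ.hasDerivWithinAt ht
  have hqp : ContinuousOn (fun t => (γ.q t, γ.p t)) (Icc 0 1) :=
    .prodMk (fun t ht => (hq t ht).continuousWithinAt) fun t ht => (hp t ht).continuousWithinAt
  have hq1 : ContDiffOn ℝ (0 + 1) γ.q (Icc 0 1) :=
    contDiffOn_succ_of_hasDerivWithinAt hunique hq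
      (contDiffOn_zero.2 ((contDiff_velocity (n := 0)).continuous.comp_continuousOn hqp))
  have hp1 : ContDiffOn ℝ (0 + 1) γ.p (Icc 0 1) :=
    contDiffOn_succ_of_hasDerivWithinAt hunique hp (contDiffOn_zero.2
      (((toL2.continuous.comp continuous_christoffel).comp_continuousOn hqp).neg))
  have hq2 : ContDiffOn ℝ ((1 : ℕ) + 1) γ.q (Icc 0 1) :=
    contDiffOn_succ_of_hasDerivWithinAt hunique hq (contDiff_velocity.comp_contDiffOn
      (by simpa only [zero_add, Nat.cast_one] using hq1.prodMk hp1))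
  exact_mod_cast hq2

end Acceleration

section Optimality

theorem mul_sq_le_mul_add_sq_add {w a u E R : ℝ} (hw : w ∈ Icc 0 E) (hu : |u| ≤ R) :
    w * a ^ 2 ≤ w * (a + u) ^ 2 + 2 * E * R * |a| := by
  have hau : w * -(a * u) ≤ E * (|a| * R) :=
    calc w * -(a * u) ≤ w * (|a| * |u|) := by
          rw [← abs_mul]
          exact mul_le_mul_of_nonneg_left (neg_le_abs _) hw.1
      _ ≤ E * (|a| * R) := by
          gcongr
          exacts [hw.1.trans hw.2, hw.2]
  linarith [mul_nonneg hw.1 (sq_nonneg u)]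

theorem lintegral_mul_sq_le {α : Type*} [MeasurableSpace α] {μ : Measure α} {w f u : α → ℝ}
    {E R : ℝ} (hER : 0 ≤ E * R) (hw : ∀ᵐ x ∂μ, w x ∈ Icc 0 E) (hu : ∀ᵐ x ∂μ, |u x| ≤ R)
    (hf : AEMeasurable f μ) :
    ∫⁻ x, ENNReal.ofReal (w x * f x ^ 2) ∂μ ≤
      ∫⁻ x, ENNReal.ofReal (w x * (f x + u x) ^ 2) ∂μ
        + ENNReal.ofReal (2 * E * R) * ∫⁻ x, ‖f x‖ₑ ∂μ := by
  have hER2 : 0 ≤ 2 * E * R := by linarith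
  rw [← lintegral_const_mul' _ _ ENNReal.ofReal_ne_top,
    ← lintegral_add_right' _ (hf.enorm.const_mul _)]
  refine lintegral_mono_ae ?_
  filter_upwards [hw, hu] with x hwx hux
  rw [← ofReal_norm, ← ENNReal.ofReal_mul hER2,
    ← ENNReal.ofReal_add (mul_nonneg hwx.1 (sq_nonneg _)) (by positivity), Real.norm_eq_abs]
  exact ENNReal.ofReal_le_ofReal (mul_sq_le_mul_add_sq_add hwx hux)

/-- The squared norm `‖(D/Dt q̇)^♭ + π_q^*(𝒰(m, q))‖_q²` at time `t`, for a measure `m` in the space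
variable; the relaxed functional integrates it over `t` with `m = Δ_t`. -/
def relaxedNormSq (γ : Path) (t : ℝ) (m : Measure ℝ) : ℝ≥0∞ :=
  ∫⁻ x in Icc (0 : ℝ) 1, ENNReal.ofReal
    (eta (γ.q t) x * (acceleration γ t x + projStar (γ.q t) (nonlocalMeas m (γ.q t)) x) ^ 2)

theorem relaxedNormSq_zero (γ : Path) (t : ℝ) : relaxedNormSq γ t 0 =
    ∫⁻ x in Icc (0 : ℝ) 1, ENNReal.ofReal (eta (γ.q t) x * acceleration γ t x ^ 2) := by
  have hU (y : ℝ) : nonlocalMeas 0 (γ.q t) y = 0 := by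
    rw [nonlocalMeas, Measure.restrict_zero, integral_zero_measure, mul_zero]
  simp only [relaxedNormSq, projStar, hU, lift_eq, mul_zero, zero_mul,
    intervalIntegral.integral_zero, sub_zero, add_zero]

variable {γ : Path} {E : ℝ}

theorem relaxedNormSq_zero_le {t : ℝ} (hE : ∀ x ∈ Icc (0 : ℝ) 1, eta (γ.q t) x ≤ E)
    (m : Measure ℝ) [IsFiniteMeasure m] :
    relaxedNormSq γ t 0 ≤ relaxedNormSq γ t m +
      ENNReal.ofReal (E ^ 2 * projStarBound E * ‖accelerationL2 γ t‖) * m univ := by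
  set R := E / 2 * m.real univ * projStarBound E with hR
  have hu (x : ℝ) (hx : x ∈ Icc (0 : ℝ) 1) :
      |projStar (γ.q t) (nonlocalMeas m (γ.q t)) x| ≤ R :=
    abs_projStar_le hE (fun y hy => abs_nonlocalMeas_le hE hy) hx
  have hE0 : 0 ≤ E := (eta_pos (γ.q t) 0).le.trans (hE 0 unitInterval.zero_mem)
  have hR0 : 0 ≤ R := (abs_nonneg _).trans (hu 0 unitInterval.zero_mem)
  have hacc : accelerationL2 γ t =ᵐ[unitMeasure] acceleration γ t := coeFn_accelerationL2 γ t
  have hL1 : ∫⁻ x, ‖acceleration γ t x‖ₑ ∂unitMeasure ≤ ENNReal.ofReal ‖accelerationL2 γ t‖ :=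
    (lintegral_congr_ae (hacc.symm.fun_comp _)).trans_le (lintegral_enorm_le _)
  calc relaxedNormSq γ t 0 ≤ relaxedNormSq γ t m
        + ENNReal.ofReal (2 * E * R) * ∫⁻ x, ‖acceleration γ t x‖ₑ ∂unitMeasure := by
        rw [relaxedNormSq_zero]
        exact lintegral_mul_sq_le (by positivity)
          (ae_unitMeasure fun x hx => ⟨(eta_pos _ x).le, hE x hx⟩) (ae_unitMeasure hu)
          ((Lp.aestronglyMeasurable _).aemeasurable.congr hacc)
    _ ≤ relaxedNormSq γ t m
        + ENNReal.ofReal (2 * E * R) * ENNReal.ofReal ‖accelerationL2 γ t‖ := by gcongr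
    _ = relaxedNormSq γ t m +
        ENNReal.ofReal (E ^ 2 * projStarBound E * ‖accelerationL2 γ t‖) * m univ := by
        rw [← ENNReal.ofReal_mul (by positivity), ← ofReal_measureReal (μ := m),
          ← ENNReal.ofReal_mul' measureReal_nonneg, hR]
        ring_nf

theorem optimalAtZero_of_norm_accelerationL2_le (P : L2 → L2 → ℝ) {ε : ℝ}
    (hη : ∀ t ∈ Icc (0 : ℝ) 1, ∀ x ∈ Icc (0 : ℝ) 1, eta (γ.q t) x ∈ Icc E⁻¹ E)
    (hε : ∀ t ∈ Icc (0 : ℝ) 1, ‖accelerationL2 γ t‖ ≤ ε)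
    (hsmall : E ^ 2 * projStarBound E * ε ≤ E⁻¹ / 4) : OptimalAtZero P γ := by
  intro Δ _ hΔ
  have hE0 : 0 < E := (eta_pos (γ.q 0) 0).trans_le
    (hη 0 unitInterval.zero_mem 0 unitInterval.zero_mem).2
  have hB0 : 0 ≤ projStarBound E := by rw [projStarBound]; positivity
  have hpoint : ∀ᵐ t ∂unitMeasure, relaxedNormSq γ t (slice 0 t) ≤
      relaxedNormSq γ t (slice Δ t) + ENNReal.ofReal (E⁻¹ / 4) * slice Δ t univ := by
    filter_upwards [ae_restrict_of_ae slice_zero_ae, ae_restrict_of_ae (slice_univ_lt_top Δ),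
      ae_restrict_mem measurableSet_Icc] with t hzero hfinite ht
    have : IsFiniteMeasure (slice Δ t) := ⟨hfinite⟩
    rw [hzero]
    refine (relaxedNormSq_zero_le (fun x hx => (hη t ht x hx).2) (slice Δ t)).trans ?_
    gcongr
    exact le_trans (by gcongr; exact hε t ht) hsmall
  have hFR : ENNReal.ofReal (E⁻¹ / 4) * Δ univ ≤ fisherRaoTime (fun z => eta (γ.q z.1) z.2) Δ :=
    ofReal_mul_mass_le_fisherRaoTime hΔ (by positivity) fun z hz => (hη z.1 hz.1 z.2 hz.2).1
  refine add_le_add_left (EReal.coe_ennreal_le_coe_ennreal_iff.2 ?_) _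
  rw [fisherRaoTime_zero, zero_add]
  calc ∫⁻ t in Icc (0 : ℝ) 1, relaxedNormSq γ t (slice 0 t)
      ≤ ∫⁻ t in Icc (0 : ℝ) 1, (relaxedNormSq γ t (slice Δ t)
        + ENNReal.ofReal (E⁻¹ / 4) * slice Δ t univ) := lintegral_mono_ae hpoint
    _ = (∫⁻ t in Icc (0 : ℝ) 1, relaxedNormSq γ t (slice Δ t))
        + ENNReal.ofReal (E⁻¹ / 4) * ∫⁻ t in Icc (0 : ℝ) 1, slice Δ t univ := by
        rw [lintegral_add_right _ ((measurable_slice_univ Δ).const_mul _),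
          lintegral_const_mul' _ _ ENNReal.ofReal_ne_top]
    _ ≤ (∫⁻ t in Icc (0 : ℝ) 1, relaxedNormSq γ t (slice Δ t))
        + ENNReal.ofReal (E⁻¹ / 4) * Δ univ := by
        gcongr
        exact setLIntegral_slice_univ_le Δ _
    _ ≤ fisherRaoTime (fun z => eta (γ.q z.1) z.2) Δ
        + ∫⁻ t in Icc (0 : ℝ) 1, relaxedNormSq γ t (slice Δ t) := by
        rw [add_comm]
        gcongr

end Optimality

section Neighborhood

/-- The two-jet `(q, q̇, q̈)` of a `C²` curve. -/
def C2Curve.twoJet (q : C2Curve) : C(Icc (0 : ℝ) 1, L2 × L2 × L2) :=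
  (q.jet 0).prodMk ((q.jet 1).prodMk (q.jet 2))

theorem C2Curve.twoJet_apply {q : ℝ → L2} (h : ContDiffOn ℝ 2 q (Icc 0 1)) (t : Icc (0 : ℝ) 1) :
    C2Curve.twoJet ⟨q, h⟩ t = (q t, derivWithin q (Icc 0 1) t,
      derivWithin (derivWithin q (Icc 0 1)) (Icc 0 1) t) := by
  change (iteratedDerivWithin 0 q (Icc 0 1) t, iteratedDerivWithin 1 q (Icc 0 1) t,
    iteratedDerivWithin 2 q (Icc 0 1) t) = _
  rw [iteratedDerivWithin_succ (n := 1), iteratedDerivWithin_one, iteratedDerivWithin_zero]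

theorem C2Curve.continuous_twoJet : Continuous C2Curve.twoJet := by
  have hjet (k : Fin 3) : Continuous fun z : C2Curve × Icc (0 : ℝ) 1 => z.1.jet k z.2 := by
    have hjet : Continuous C2Curve.jet := continuous_induced_dom
    exact (((continuous_apply k).comp hjet).comp continuous_fst).eval continuous_snd
  exact ContinuousMap.continuous_of_continuous_uncurry _
    ((hjet 0).prodMk ((hjet 1).prodMk (hjet 2)))

theorem C2Curve.isOpen_setOf_forall_twoJet_mem {W : Set (L2 × L2 × L2)} (hW : IsOpen W) :
    IsOpen {q : C2Curve | ∀ t, q.twoJet t ∈ W} := by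
  simpa only [MapsTo, mem_univ, true_imp_iff, preimage_ofPred_eq] using
    (ContinuousMap.isOpen_setOfPred_mapsTo isCompact_univ hW).preimage C2Curve.continuous_twoJet

theorem isOpen_setOf_norm_lt_and_norm_jetAcceleration_lt (K ε : ℝ) :
    IsOpen {z : L2 × L2 × L2 | ‖z.1‖ < K ∧ ‖jetAcceleration z‖ < ε} :=
  (isOpen_lt continuous_fst.norm continuous_const).inter
    (isOpen_lt continuous_jetAcceleration.norm continuous_const)

theorem exists_optimalAtZero_of_norm_lt (P : L2 → L2 → ℝ) (K : ℝ) : ∃ ε > 0, ∀ γ : Path,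
    (∀ t ∈ Icc (0 : ℝ) 1, ‖γ.q t‖ < K ∧ ‖accelerationL2 γ t‖ < ε) → OptimalAtZero P γ := by
  have hc : 0 < Real.exp K ^ 2 * projStarBound (Real.exp K) := by
    rw [projStarBound]
    positivity
  refine ⟨(Real.exp K)⁻¹ / 4 / (Real.exp K ^ 2 * projStarBound (Real.exp K)), by positivity,
    fun γ hγ => optimalAtZero_of_norm_accelerationL2_le P
      (fun t ht x hx => eta_mem_Icc (hγ t ht).1.le hx) (fun t ht => (hγ t ht).2.le)
      (mul_div_cancel₀ _ hc.ne').le⟩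

end Neighborhood

end

end DiffSpline

open DiffSpline in
theorem mainTheorem11_general (P : L2 → L2 → ℝ) {C : Set Path}
    (hC : ∀ γ' ∈ C, FirstEquation γ') {γ : Path} (hγ : IsGeodesic γ) :
    ContainsC2Neighborhood C {γ' ∈ C | OptimalAtZero P γ'} γ := by
  obtain ⟨K, hK⟩ := isCompact_Icc.exists_bound_of_continuousOn hγ.contDiffOn.continuousOn
  obtain ⟨ε, hε, hoptimal⟩ := exists_optimalAtZero_of_norm_lt P (K + 1)
  have hmem {γ' : Path} (hF : FirstEquation γ') (hq : ContDiffOn ℝ 2 γ'.q (Icc 0 1)) :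
      (∀ t, C2Curve.twoJet ⟨γ'.q, hq⟩ t ∈ {z | ‖z.1‖ < K + 1 ∧ ‖jetAcceleration z‖ < ε}) ↔
        ∀ t ∈ Icc (0 : ℝ) 1, ‖γ'.q t‖ < K + 1 ∧ ‖accelerationL2 γ' t‖ < ε := by
    rw [Subtype.forall]
    refine forall₂_congr fun t ht => ?_
    rw [C2Curve.twoJet_apply hq ⟨t, ht⟩, hF.accelerationL2_eq hq ht, mem_ofPred_eq]
  refine ⟨hγ.contDiffOn, _, C2Curve.isOpen_setOf_forall_twoJet_mem
    (isOpen_setOf_norm_lt_and_norm_jetAcceleration_lt (K + 1) ε), ?_, ?_⟩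
  · refine (hmem hγ.1 hγ.contDiffOn).2 fun t ht => ⟨(hK t ht).trans_lt (lt_add_one K), ?_⟩
    rwa [hγ.accelerationL2_eq_zero ht, norm_zero]
  · exact fun γ' hγ' hq hU => ⟨hγ', hoptimal γ' ((hmem (hC γ' hγ') hq).1 hU)⟩

theorem mainTheorem11
    (P : DiffSpline.L2 → DiffSpline.L2 → ℝ)
    (p₀ q₀ p₁ q₁ : DiffSpline.L2)
    (C : Set DiffSpline.Path)
    (hC : C = DiffSpline.curves0 p₀ q₀ ∨ C = DiffSpline.curves01 p₀ q₀ p₁ q₁)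
    (γ : DiffSpline.Path) (hγC : γ ∈ C) (hγ : DiffSpline.IsGeodesic γ) :
    DiffSpline.ContainsC2Neighborhood C {γ' ∈ C | DiffSpline.OptimalAtZero P γ'} γ := by
  refine mainTheorem11_general P (fun γ' hγ' => ?_) hγ
  rcases hC with rfl | rfl
  exacts [hγ'.2.2.1, hγ'.1.2.2.1]
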